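/- Let $n\ge 2$ and let $S^{n\times n}$ be the set of symmetric real $n\times n$ matrices, ordered by $X\le Y$ iff $Y-X$ is positive semidefinite. Let $H:\mathbb{R}^n\times S^{n\times n}\to\mathbb{R}$ satisfy the following. (A) $H$ is continuous, $H(q,X)\le H(q,Y)$ whenever $X\le Y$, and $H(q,O)=0$ for all $q$. (B) There is $k_1\ge 0$ such that $H(\theta q,X)=|\theta|^{k_1}H(q,X)$ for all $\theta\in\mathbb{R}$, and $H(q,\theta X)=\theta H(q,X)$ for all $\theta>0$. (C) $\max_{|e|=1}H(e,-I)<0<\min_{|e|=1}H(e,I)$. Put $\Lambda^{\sup}=\sup_{\lambda\in\mathbb{R}}\max_{|e|=1}H(e,\lambda e\otimes e+I)$ and assume $\Lambda^{\sup}<\infty$. Let $k=k_1+1$ and $\gamma=k+1$, and assume $k>1$ (so $\gamma>2$). Put $\gamma^*=\gamma/(\gamma-2)$ and, for $\sigma>1$, $\sigma^*=\sigma/(\sigma-1)$. Let $0<T<\infty$, let $h:\mathbb{R}^n\to\mathbb{R}$ be continuous with $\sup_{\mathbb{R}^n}h<\infty$, let $\chi:(0,T)\to\mathbb{R}$ be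 continuous and bounded, and let $\sigma\ge 0$. Let $m\in[-\infty,\infty)$ and let $Z$ be a continuous non-increasing function with values in $[0,\infty)$ on $\{s\in\mathbb{R}:s\ge m\}$. Let $u:\mathbb{R}^n\times[0,T)\to\mathbb{R}$ be upper semicontinuous with $u(x,0)\le h(x)$ for all $x$, and, if $m>-\infty$, $\inf_{\mathbb{R}^n\times(0,T)}u>m$. Assume that $u$ satisfies $$H\big(Du,\,D^2u+Z(u)\,Du\otimes Du\big)+\chi(t)|Du|^{\sigma}-u_t\ge 0\quad\text{in }\mathbb{R}^n\times(0,T)$$ in the viscosity sense: whenever $\psi$ is $C^1$ in $t$ and $C^2$ in $x$ and $u-\psi$ has a local maximum at $(y,s)\in\mathbb{R}^n\times(0,T)$, then $$H\big(D\psi,\,D^2\psi+Z(u)\,D\psi\otimes D\psi\big)+\chi(s)|D\psi|^\sigma-\psi_t\ge 0\quad\text{at }(y,s)$$ (for $\sigma=0$ the term $|D\psi|^\sigma$ is $1$). Fix $z\in\mathbb{R}^n$, and for $\beta>0$ consider the growth condition $$\sup_{|x-z|\le R,\;0<t<T}u(x,t)=o(R^{\beta})\quad\text{as }R\to\infty,\tag{$G_\beta$}$$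 where the suprema are understood to be finite. Then the following hold. (a) Suppose that $0\le\sigma\le\gamma/2$ and that $(G_\beta)$ holds with $\beta=\gamma^*$. If $\sigma=0$, then $u(x,t)\le\sup_{\mathbb{R}^n}h+t\,\sup_{0<s<T}|\chi(s)|$ for all $(x,t)\in\mathbb{R}^n\times(0,T)$. If $0<\sigma\le\gamma/2$, then $\sup_{\mathbb{R}^n\times(0,T)}u\le\sup_{\mathbb{R}^n}h$. (b) If $\sigma>\gamma/2$ and $(G_\beta)$ holds with $\beta=\sigma^*$, then $\sup_{\mathbb{R}^n\times(0,T)}u\le\sup_{\mathbb{R}^n}h$. -/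

import Mathlib

open Set Filter Topology Asymptotics

noncomputable section

/-- The space `ℝⁿ` with its Euclidean norm. -/
abbrev Eucl (n : ℕ) : Type := EuclideanSpace ℝ (Fin n)

/-- Square real matrices. An operator `H` is written as a function on all of them, but every
condition below, and every use of `H`, concerns symmetric matrices only. -/
abbrev Mat (n : ℕ) : Type := Matrix (Fin n) (Fin n) ℝ

/-- The matrix `q ⊗ q`, with entries `qᵢ qⱼ`. -/
def tensorSq {n : ℕ} (q : Eucl n) : Mat n := Matrix.of fun i j => q i * q j

/-- Condition A: `H` is continuous on `ℝⁿ × S^{n×n}`, nondecreasing in the matrix variable for the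
order `X ≤ Y` iff `Y - X` is positive semidefinite, and `H(q, O) = 0`. -/
structure ConditionA {n : ℕ} (H : Eucl n → Mat n → ℝ) : Prop where
  continuousOn : ContinuousOn (fun a : Eucl n × Mat n => H a.1 a.2) {a | a.2.IsSymm}
  mono : ∀ (q : Eucl n) (X Y : Mat n), X.IsSymm → Y.IsSymm → (Y - X).PosSemidef → H q X ≤ H q Y
  zero : ∀ q : Eucl n, H q 0 = 0

/-- Condition B: homogeneity of degree `k₁ ≥ 0` in the gradient variable, and positive homogeneity
of degree one in the matrix variable. -/
structure ConditionB {n : ℕ} (H : Eucl n → Mat n → ℝ) (k₁ : ℝ) : Prop where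
  nonneg : 0 ≤ k₁
  grad : ∀ (θ : ℝ) (q : Eucl n) (X : Mat n), X.IsSymm → H (θ • q) X = |θ| ^ k₁ * H q X
  mat : ∀ (θ : ℝ) (q : Eucl n) (X : Mat n), X.IsSymm → 0 < θ → H q (θ • X) = θ * H q X

/-- Condition C: `max_{|e|=1} H(e, -I) < 0 < min_{|e|=1} H(e, I)`. -/
structure ConditionC {n : ℕ} (H : Eucl n → Mat n → ℝ) : Prop where
  max_neg : (⨆ e : Metric.sphere (0 : Eucl n) 1, H e (-1)) < 0
  min_pos : 0 < ⨅ e : Metric.sphere (0 : Eucl n) 1, H e 1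

/-- `Λ_max(λ) = max_{|e|=1} H(e, λ e ⊗ e + I)`. -/
def LambdaMax {n : ℕ} (H : Eucl n → Mat n → ℝ) (l : ℝ) : ℝ :=
  ⨆ e : Metric.sphere (0 : Eucl n) 1, H e (l • tensorSq (e : Eucl n) + 1)

/-- `Λ^sup = sup_λ Λ_max(λ)` is finite. -/
def LambdaSupFinite {n : ℕ} (H : Eucl n → Mat n → ℝ) : Prop :=
  BddAbove (range (LambdaMax H))

/-- `ψ` is a test function on `ℝⁿ × (0, T)`: it is `C¹` in `t` and `C²` in `x`, with time derivative
`ψt`, spatial gradient `Dψ` and spatial Hessian `D2ψ`, all three continuous in `(x, t)`.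
(Symmetry of the Hessian is automatic; it is recorded for convenience.) -/
structure IsTestFunction {n : ℕ} (T : ℝ) (ψ ψt : Eucl n → ℝ → ℝ) (Dψ : Eucl n → ℝ → Eucl n)
    (D2ψ : Eucl n → ℝ → Mat n) : Prop where
  time : ∀ x, ∀ t ∈ Ioo 0 T, HasDerivAt (fun τ => ψ x τ) (ψt x t) t
  grad : ∀ x, ∀ t ∈ Ioo 0 T, HasGradientAt (fun y => ψ y t) (Dψ x t) x
  hess : ∀ x, ∀ t ∈ Ioo 0 T,
    HasFDerivAt (fun y => Dψ y t) (Matrix.toEuclideanCLM (n := Fin n) (𝕜 := ℝ) (D2ψ x t)) x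
  symm : ∀ x, ∀ t ∈ Ioo 0 T, (D2ψ x t).IsSymm
  time_cont : ContinuousOn (fun a : Eucl n × ℝ => ψt a.1 a.2) (univ ×ˢ Ioo 0 T)
  grad_cont : ContinuousOn (fun a : Eucl n × ℝ => Dψ a.1 a.2) (univ ×ˢ Ioo 0 T)
  hess_cont : ContinuousOn (fun a : Eucl n × ℝ => D2ψ a.1 a.2) (univ ×ˢ Ioo 0 T)

/-- Viscosity sense of
`H(Du, D²u + Z(u) Du ⊗ Du) + χ(t) |Du|^σ - u_t ≥ 0` in `ℝⁿ × (0, T)`: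
whenever `u - ψ` has a local maximum at a point of `ℝⁿ × (0, T)`, for a test function `ψ`, the
inequality holds there with the derivatives of `ψ` in place of those of `u`.
Real powers satisfy `0 ^ 0 = 1`, so for `σ = 0` the middle term is `χ(t)`. -/
def IsViscSubsolution {n : ℕ} (T : ℝ) (H : Eucl n → Mat n → ℝ) (Z χ : ℝ → ℝ) (σ : ℝ)
    (u : Eucl n → ℝ → ℝ) : Prop :=
  ∀ (ψ ψt : Eucl n → ℝ → ℝ) (Dψ : Eucl n → ℝ → Eucl n) (D2ψ : Eucl n → ℝ → Mat n),
    IsTestFunction T ψ ψt Dψ D2ψ →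
    ∀ y, ∀ s ∈ Ioo 0 T,
      IsLocalMax (fun a : Eucl n × ℝ => u a.1 a.2 - ψ a.1 a.2) (y, s) →
      0 ≤ H (Dψ y s) (D2ψ y s + Z (u y s) • tensorSq (Dψ y s))
            + χ s * ‖Dψ y s‖ ^ σ - ψt y s

/-- `sup_{|x - z| ≤ R, 0 < t < T} u(x, t) = o(R^β)` as `R → ∞`, the suprema being finite. -/
def SupIsLittleO {n : ℕ} (T : ℝ) (z : Eucl n) (u : Eucl n → ℝ → ℝ) (β : ℝ) : Prop :=
  (∀ R : ℝ, 0 < R →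
    BddAbove ((fun a : Eucl n × ℝ => u a.1 a.2) '' (Metric.closedBall z R ×ˢ Ioo 0 T))) ∧
  (fun R : ℝ =>
    sSup ((fun a : Eucl n × ℝ => u a.1 a.2) '' (Metric.closedBall z R ×ˢ Ioo 0 T)))
      =o[atTop] (fun R : ℝ => R ^ β)

end

/-! Compare `u` with ψ = M + dt + ε e^{Kt} (1 + |x - z|²)^{β/2} + η/(T - t), where M = sup h. The
growth condition puts `u` below ψ far from z, and η/(T - t) does so near t = T, so if `u` exceeds ψ
somewhere then u - ψ has an interior maximum. There the Hessian of ψ plus Z(u) Dψ ⊗ Dψ has the form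
μ w ⊗ w + A I with w = x - z and Dψ = A w; homogeneity and Λ^sup < ∞ bound H by L A^{k₁+1}|w|^{k₁}
whatever μ is (`apply_radial_le`). This bound is O(|w|^β) when (β - 1)k₁ ≤ 2, and |Dψ|^σ is when (β
- 1)σ ≤ β; a large K then makes ψ_t win (`exists_barrier_rate`), a contradiction
(`IsViscSubsolution.le_barrier`). Finally ε = η → 0 and, if σ > 0, d → 0. The exponents γ* and σ*
each turn one of the two conditions into an equality. -/

/-- `1 + |x - z|²`, the smooth substitute for `|x - z|²` in the barriers. -/
noncomputable def bracketSq {n : ℕ} (z x : Eucl n) : ℝ := 1 + ‖x - z‖ ^ 2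

theorem one_le_bracketSq {n : ℕ} (z x : Eucl n) : 1 ≤ bracketSq z x := by
  unfold bracketSq; nlinarith [sq_nonneg ‖x - z‖]

theorem bracketSq_pos {n : ℕ} (z x : Eucl n) : 0 < bracketSq z x :=
  lt_of_lt_of_le one_pos (one_le_bracketSq z x)

theorem continuous_bracketSq {n : ℕ} (z : Eucl n) : Continuous (bracketSq z) := by
  unfold bracketSq; fun_prop

theorem continuous_bracketSq_rpow {n : ℕ} (z : Eucl n) (p : ℝ) :
    Continuous fun x => bracketSq z x ^ p :=
  (continuous_bracketSq z).rpow_const fun x => Or.inl (bracketSq_pos z x).ne'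

theorem hasFDerivAt_bracketSq_rpow {n : ℕ} (z x : Eucl n) (p : ℝ) :
    HasFDerivAt (fun y => bracketSq z y ^ p)
      ((2 * p * bracketSq z x ^ (p - 1)) • innerSL ℝ (x - z)) x := by
  have h1 : HasFDerivAt (bracketSq z) ((2 : ℝ) • innerSL ℝ (x - z)) x := by
    have := ((hasFDerivAt_id (𝕜 := ℝ) x).sub_const z).norm_sq.const_add 1
    refine this.congr_fderiv ?_
    ext v; simp
  refine (h1.rpow_const (Or.inl (bracketSq_pos z x).ne')).congr_fderiv ?_
  ext v; simp; ring

theorem toEuclideanCLM_tensorSq_apply {n : ℕ} (w v : Eucl n) :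
    Matrix.toEuclideanCLM (n := Fin n) (𝕜 := ℝ) (tensorSq w) v = inner ℝ w v • w := by
  ext i
  simp only [Matrix.ofLp_toEuclideanCLM, Matrix.mulVec, dotProduct, tensorSq, Matrix.of_apply,
    PiLp.smul_apply, PiLp.inner_apply, smul_eq_mul, Finset.sum_mul]
  exact Finset.sum_congr rfl fun j _ => by simp; ring

theorem tensorSq_smul {n : ℕ} (c : ℝ) (w : Eucl n) : tensorSq (c • w) = c ^ 2 • tensorSq w := by
  ext i j; simp [tensorSq]; ring

theorem isSymm_tensorSq {n : ℕ} (w : Eucl n) : (tensorSq w).IsSymm := by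
  ext i j; simp [tensorSq, mul_comm]

theorem continuous_tensorSq {n : ℕ} : Continuous (tensorSq (n := n)) := by
  refine continuous_matrix fun i j => ?_
  simp only [tensorSq, Matrix.of_apply]
  fun_prop

theorem isSymm_smul_tensorSq_add {n : ℕ} (l c : ℝ) (w : Eucl n) :
    (l • tensorSq w + c • (1 : Mat n)).IsSymm :=
  ((isSymm_tensorSq w).smul l).add (Matrix.isSymm_one.smul c)

/-! ### Bounds for the operator on radial functions -/

/-- For `e` a unit vector, `H(e, λ e ⊗ e + I)` is bounded uniformly in `e` and `λ`. -/
theorem exists_bound_of_lambdaSupFinite {n : ℕ} {H : Eucl n → Mat n → ℝ} (hA : ConditionA H)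
    (hΛ : LambdaSupFinite H) :
    ∃ L : ℝ, 0 ≤ L ∧ ∀ (e : Eucl n) (l : ℝ), ‖e‖ = 1 → H e (l • tensorSq e + 1) ≤ L := by
  obtain ⟨L, hL⟩ := hΛ
  refine ⟨max L 0, le_max_right _ _, fun e l he => le_max_of_le_left ?_⟩
  refine le_trans ?_ (hL ⟨l, rfl⟩)
  -- An unbounded real supremum defaults to 0; continuity on the compact sphere makes this one
  -- genuine.
  have hcont : Continuous fun e : Metric.sphere (0 : Eucl n) 1 =>
      H e (l • tensorSq (e : Eucl n) + 1) := by
    refine hA.continuousOn.comp_continuous (f := fun e : Metric.sphere (0 : Eucl n) 1 =>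
      ((e : Eucl n), l • tensorSq (e : Eucl n) + (1 : Mat n))) ?_ fun e => ?_
    · have := (continuous_tensorSq (n := n)).comp
        (continuous_subtype_val (p := fun x => x ∈ Metric.sphere (0 : Eucl n) 1))
      exact continuous_subtype_val.prodMk ((this.const_smul l).add continuous_const)
    · simpa using isSymm_smul_tensorSq_add l 1 (e : Eucl n)
  exact le_ciSup (f := fun e : Metric.sphere (0 : Eucl n) 1 =>
    H e (l • tensorSq (e : Eucl n) + 1)) (isCompact_range hcont).bddAbove ⟨e, by simpa using he⟩

/-- Upper bound for `H` at the gradient and Hessian of a radial function. -/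
theorem apply_radial_le {n : ℕ} {H : Eucl n → Mat n → ℝ} {k₁ L : ℝ} (hB : ConditionB H k₁)
    (hk₁ : 0 < k₁) (hL : ∀ (e : Eucl n) (l : ℝ), ‖e‖ = 1 → H e (l • tensorSq e + 1) ≤ L)
    {A : ℝ} (hA : 0 < A) (μ : ℝ) (w : Eucl n) :
    H (A • w) (μ • tensorSq w + A • 1) ≤ L * (A ^ (k₁ + 1) * ‖w‖ ^ k₁) := by
  rcases eq_or_ne w 0 with rfl | hw
  -- No direction e exists here, but gradient homogeneity with θ = 0 and k₁ > 0 forces H(0, ·) = 0.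
  · have := hB.grad 0 0 (μ • tensorSq 0 + A • 1) (isSymm_smul_tensorSq_add _ _ _)
    simp [Real.zero_rpow hk₁.ne'] at this
    simp [this, Real.zero_rpow hk₁.ne']
  · have hr : 0 < ‖w‖ := norm_pos_iff.2 hw
    set e : Eucl n := ‖w‖⁻¹ • w with he
    have hen : ‖e‖ = 1 := by rw [he, norm_smul]; simp [hr.ne']
    have hwe : w = ‖w‖ • e := by simp [he, smul_smul, hr.ne']
    have h1 : μ • tensorSq w + A • (1 : Mat n) =
        A • ((μ * ‖w‖ ^ 2 / A) • tensorSq e + 1) := by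
      conv_lhs => rw [hwe, tensorSq_smul]
      rw [smul_add, smul_smul, smul_smul]
      congr 2
      field_simp
    have h2 : A • w = (A * ‖w‖) • e := by conv_lhs => rw [hwe, smul_smul]
    have hs : ∀ l : ℝ, (l • tensorSq e + (1 : Mat n)).IsSymm := fun l => by
      simpa using isSymm_smul_tensorSq_add l 1 e
    rw [h1, h2, hB.mat _ _ _ (hs _) hA, hB.grad _ _ _ (hs _), abs_of_pos (by positivity),
      Real.mul_rpow hA.le hr.le, Real.rpow_add_one hA.ne']
    have := hL e (μ * ‖w‖ ^ 2 / A) hen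
    calc A * (A ^ k₁ * ‖w‖ ^ k₁ * H e ((μ * ‖w‖ ^ 2 / A) • tensorSq e + 1))
        ≤ A * (A ^ k₁ * ‖w‖ ^ k₁ * L) := by gcongr
      _ = _ := by ring

/-! ### The barrier and its derivatives -/

/-- The barrier `M + d t + ε e^{K t} (1 + |x - z|²)^{β/2} + η / (T - t)`. -/
noncomputable def barrier {n : ℕ} (T M d K ε η β : ℝ) (z x : Eucl n) (t : ℝ) : ℝ :=
  M + d * t + ε * Real.exp (K * t) * bracketSq z x ^ (β / 2) + η / (T - t)

noncomputable def barrierTime {n : ℕ} (T d K ε η β : ℝ) (z x : Eucl n) (t : ℝ) : ℝ :=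
  d + K * (ε * Real.exp (K * t)) * bracketSq z x ^ (β / 2) + η / (T - t) ^ 2

/-- The spatial gradient of the barrier is this multiple of `x - z`. -/
noncomputable def barrierSlope {n : ℕ} (K ε β : ℝ) (z x : Eucl n) (t : ℝ) : ℝ :=
  β * (ε * Real.exp (K * t)) * bracketSq z x ^ (β / 2 - 1)

noncomputable def barrierHess {n : ℕ} (K ε β : ℝ) (z x : Eucl n) (t : ℝ) : Mat n :=
  (β * (ε * Real.exp (K * t)) * (2 * (β / 2 - 1) * bracketSq z x ^ (β / 2 - 1 - 1))) •
    tensorSq (x - z) + barrierSlope K ε β z x t • 1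

theorem barrierSlope_pos {n : ℕ} {K ε β : ℝ} (hε : 0 < ε) (hβ : 0 < β) (z x : Eucl n) (t : ℝ) :
    0 < barrierSlope K ε β z x t := by
  have := Real.rpow_pos_of_pos (bracketSq_pos z x) (β / 2 - 1)
  unfold barrierSlope; positivity

theorem continuous_barrierSlope {n : ℕ} (K ε β : ℝ) (z : Eucl n) :
    Continuous fun a : Eucl n × ℝ => barrierSlope K ε β z a.1 a.2 := by
  have := (continuous_bracketSq_rpow z (β / 2 - 1)).comp (continuous_fst (X := Eucl n) (Y := ℝ))
  unfold barrierSlope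
  exact (by fun_prop : Continuous fun a : Eucl n × ℝ => β * (ε * Real.exp (K * a.2))).mul this

theorem isTestFunction_barrier {n : ℕ} (T M d K ε η β : ℝ) (z : Eucl n) :
    IsTestFunction T (barrier T M d K ε η β z) (barrierTime T d K ε η β z)
      (fun x t => barrierSlope K ε β z x t • (x - z)) (barrierHess K ε β z) where
  time x t ht := by
    have h0 : T - t ≠ 0 := (sub_pos.2 ht.2).ne'
    have h1 : HasDerivAt (fun τ => Real.exp (K * τ)) (Real.exp (K * t) * (K * 1)) t :=
      ((hasDerivAt_id t).const_mul K).exp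
    have h2 : HasDerivAt (fun τ => η / (T - τ)) ((0 * (T - t) - η * -1) / (T - t) ^ 2) t :=
      (hasDerivAt_const t η).div ((hasDerivAt_id t).const_sub T) h0
    have h3 := (((((hasDerivAt_id t).const_mul d).const_add M).add
      ((h1.const_mul ε).mul_const (bracketSq z x ^ (β / 2)))).add h2)
    refine h3.congr_deriv ?_
    simp only [barrierTime]; ring
  grad x t ht := by
    rw [hasGradientAt_iff_hasFDerivAt]
    have h1 := (((hasFDerivAt_bracketSq_rpow z x (β / 2)).const_mul
      (ε * Real.exp (K * t))).const_add (M + d * t)).add_const (η / (T - t))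
    refine h1.congr_fderiv ?_
    ext v
    simp [barrierSlope]; ring
  hess x t ht := by
    have h1 := ((hasFDerivAt_bracketSq_rpow z x (β / 2 - 1)).const_mul
      (β * (ε * Real.exp (K * t)))).smul ((hasFDerivAt_id (𝕜 := ℝ) x).sub_const z)
    refine h1.congr_fderiv ?_
    ext1 v
    simp only [barrierHess, map_add, map_smul, map_one, add_apply,
      smul_apply, toEuclideanCLM_tensorSq_apply, barrierSlope,
      ContinuousLinearMap.smulRight_apply, innerSL_apply_apply, one_apply_eq_self,
      ContinuousLinearMap.id_apply, id, smul_eq_mul, smul_smul]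
    rw [add_comm]
  symm x t ht := isSymm_smul_tensorSq_add _ _ _
  time_cont := by
    have h1 := (continuous_bracketSq_rpow z (β / 2)).comp (continuous_fst (X := Eucl n) (Y := ℝ))
    unfold barrierTime
    refine ContinuousOn.add (Continuous.continuousOn ?_) ?_
    · exact continuous_const.add
        ((by fun_prop : Continuous fun a : Eucl n × ℝ => K * (ε * Real.exp (K * a.2))).mul h1)
    · refine continuousOn_const.div (by fun_prop) fun a ha => ?_
      exact pow_ne_zero 2 (sub_pos.2 ha.2.2).ne'
  grad_cont :=
    ((continuous_barrierSlope K ε β z).smul (continuous_fst.sub continuous_const)).continuousOn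
  hess_cont := by
    have h1 := (continuous_bracketSq_rpow z (β / 2 - 1 - 1)).comp
      (continuous_fst (X := Eucl n) (Y := ℝ))
    have h2 : Continuous fun a : Eucl n × ℝ => tensorSq (a.1 - z) :=
      continuous_tensorSq.comp (continuous_fst.sub continuous_const)
    unfold barrierHess
    exact ((((by fun_prop : Continuous fun a : Eucl n × ℝ => β * (ε * Real.exp (K * a.2))).mul
      (continuous_const.mul h1)).smul h2).add
      ((continuous_barrierSlope K ε β z).smul continuous_const)).continuousOn

/-! ### Power estimates and the choice of K -/

theorem rpow_mul_rpow_le_of_exponent_le {β p r a b : ℝ} (hβ : 0 < β) (hp : 0 < p) (hr : 0 ≤ r)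
    (hb : 0 ≤ b) (hab : a * (β / 2 - 1) + b / 2 ≤ β / 2) :
    (β * p * (1 + r ^ 2) ^ (β / 2 - 1)) ^ a * r ^ b ≤ (β * p) ^ a * (1 + r ^ 2) ^ (β / 2) := by
  have hs : 1 ≤ 1 + r ^ 2 := by nlinarith [sq_nonneg r]
  have hs0 : 0 < 1 + r ^ 2 := by linarith
  have hrb : r ^ b ≤ (1 + r ^ 2) ^ (b / 2) := by
    have h1 : r ^ b = (r ^ 2) ^ (b / 2) := by
      rw [← Real.rpow_natCast, ← Real.rpow_mul hr]; congr 1; push_cast; ring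
    rw [h1]
    exact Real.rpow_le_rpow (by positivity) (by linarith) (by positivity)
  rw [Real.mul_rpow (by positivity) (by positivity), ← Real.rpow_mul hs0.le, mul_assoc]
  refine mul_le_mul_of_nonneg_left ?_ (by positivity)
  calc (1 + r ^ 2) ^ ((β / 2 - 1) * a) * r ^ b
      ≤ (1 + r ^ 2) ^ ((β / 2 - 1) * a) * (1 + r ^ 2) ^ (b / 2) := by gcongr
    _ = (1 + r ^ 2) ^ (a * (β / 2 - 1) + b / 2) := by rw [← Real.rpow_add hs0]; congr 1; ring
    _ ≤ _ := Real.rpow_le_rpow_of_exponent_le hs hab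

/-- Splits at q₀ = δ^{1/σ}, where q^σ = δ; beyond it q^{σ-1} ≤ q₀^{σ-1} because σ ≤ 1. -/
theorem exists_rpow_le_add_mul {σ δ : ℝ} (hσ : 0 < σ) (hσ1 : σ ≤ 1) (hδ : 0 < δ) :
    ∃ N : ℝ, 0 ≤ N ∧ ∀ q : ℝ, 0 ≤ q → q ^ σ ≤ δ + N * q := by
  set q₀ := δ ^ σ⁻¹
  have hq₀ : 0 < q₀ := Real.rpow_pos_of_pos hδ _
  refine ⟨q₀ ^ (σ - 1), by positivity, fun q hq => ?_⟩
  rcases le_total q q₀ with hle | hle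
  · have h1 : q ^ σ ≤ δ := by
      refine (Real.rpow_le_rpow hq hle hσ.le).trans_eq ?_
      rw [← Real.rpow_mul hδ.le, inv_mul_cancel₀ hσ.ne', Real.rpow_one]
    have : 0 ≤ q₀ ^ (σ - 1) * q := by positivity
    linarith
  · have hqp : 0 < q := hq₀.trans_le hle
    have h1 : q ^ σ = q ^ (σ - 1) * q := by
      rw [← Real.rpow_add_one hqp.ne']; congr 1; ring
    have h2 : q ^ (σ - 1) ≤ q₀ ^ (σ - 1) :=
      Real.rpow_le_rpow_of_nonpos hq₀ hle (by linarith)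
    rw [h1]
    nlinarith

/-- The growth rate `K` for which the barrier is a supersolution. -/
theorem exists_barrier_rate {β σ k₁ L C d : ℝ} (hβ : 0 < β) (hk₁ : 0 ≤ k₁) (hL : 0 ≤ L)
    (hC : 0 ≤ C) (hβk : (β - 1) * k₁ ≤ 2) (hσ : 0 ≤ σ) (hβσ : (β - 1) * σ ≤ β)
    (hd : 0 ≤ d) (hd0 : σ = 0 → C ≤ d) (hd1 : 0 < σ → 0 < d) :
    ∃ K : ℝ, 0 ≤ K ∧ ∀ p r : ℝ, 0 < p → p ≤ 1 → 0 ≤ r →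
      L * ((β * p * (1 + r ^ 2) ^ (β / 2 - 1)) ^ (k₁ + 1) * r ^ k₁) +
        C * (β * p * (1 + r ^ 2) ^ (β / 2 - 1) * r) ^ σ ≤ d + K * p * (1 + r ^ 2) ^ (β / 2) := by
  -- Since p ≤ 1, powers a ≥ 1 of p are at most p, so K need not depend on ε.
  have hpow : ∀ a p : ℝ, 1 ≤ a → 0 < p → p ≤ 1 → (β * p) ^ a ≤ β ^ a * p := fun a p ha hp hp1 => by
    rw [Real.mul_rpow hβ.le hp.le]
    gcongr
    simpa using Real.rpow_le_rpow_of_exponent_ge hp hp1 ha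
  have hmain : ∀ p r : ℝ, 0 < p → p ≤ 1 → 0 ≤ r →
      L * ((β * p * (1 + r ^ 2) ^ (β / 2 - 1)) ^ (k₁ + 1) * r ^ k₁) ≤
        L * β ^ (k₁ + 1) * p * (1 + r ^ 2) ^ (β / 2) := fun p r hp hp1 hr => by
    -- The exponent condition here is equivalent to (β - 1)k₁ ≤ 2.
    have h1 := rpow_mul_rpow_le_of_exponent_le (a := k₁ + 1) (b := k₁) hβ hp hr hk₁ (by nlinarith)
    have h2 := hpow (k₁ + 1) p (by linarith) hp hp1
    calc _ ≤ L * ((β * p) ^ (k₁ + 1) * (1 + r ^ 2) ^ (β / 2)) := by gcongr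
      _ ≤ L * (β ^ (k₁ + 1) * p * (1 + r ^ 2) ^ (β / 2)) := by gcongr
      _ = _ := by ring
  suffices ∃ N : ℝ, 0 ≤ N ∧ ∀ p r : ℝ, 0 < p → p ≤ 1 → 0 ≤ r →
      C * (β * p * (1 + r ^ 2) ^ (β / 2 - 1) * r) ^ σ ≤ d + N * p * (1 + r ^ 2) ^ (β / 2) by
    obtain ⟨N, hN, hNb⟩ := this
    refine ⟨L * β ^ (k₁ + 1) + N, by positivity, fun p r hp hp1 hr => ?_⟩
    have := hmain p r hp hp1 hr
    have := hNb p r hp hp1 hr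
    linarith
  rcases hσ.eq_or_lt with rfl | hσ0
  · exact ⟨0, le_rfl, fun p r _ _ _ => by simpa using hd0 rfl⟩
  rcases le_total σ 1 with hσ1 | hσ1
  -- For σ < 1, p^σ is not O(p) as p → 0; the constant d > 0 absorbs the excess.
  · have hd' := hd1 hσ0
    obtain ⟨N, hN, hNb⟩ := exists_rpow_le_add_mul hσ0 hσ1 (δ := d / (C + 1)) (by positivity)
    refine ⟨C * N * β, by positivity, fun p r hp hp1 hr => ?_⟩
    have h1 := rpow_mul_rpow_le_of_exponent_le (a := 1) (b := 1) hβ hp hr zero_le_one (by linarith)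
    simp only [Real.rpow_one] at h1
    have h2 := hNb (β * p * (1 + r ^ 2) ^ (β / 2 - 1) * r) (by positivity)
    have h3 : C * (d / (C + 1)) ≤ d := by
      rw [mul_div_assoc', div_le_iff₀ (by positivity)]; nlinarith
    calc _ ≤ C * (d / (C + 1) + N * (β * p * (1 + r ^ 2) ^ (β / 2))) := by
          refine mul_le_mul_of_nonneg_left (h2.trans ?_) hC
          gcongr
      _ = C * (d / (C + 1)) + C * N * β * p * (1 + r ^ 2) ^ (β / 2) := by ring
      _ ≤ _ := by linarith
  · refine ⟨C * β ^ σ, by positivity, fun p r hp hp1 hr => ?_⟩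
    have h1 := rpow_mul_rpow_le_of_exponent_le (a := σ) (b := σ) hβ hp hr hσ (by nlinarith)
    have h2 := hpow σ p hσ1 hp hp1
    rw [Real.mul_rpow (by positivity) hr]
    calc _ ≤ C * ((β * p) ^ σ * (1 + r ^ 2) ^ (β / 2)) := by gcongr
      _ ≤ C * (β ^ σ * p * (1 + r ^ 2) ^ (β / 2)) := by gcongr
      _ = C * β ^ σ * p * (1 + r ^ 2) ^ (β / 2) := by ring
      _ ≤ _ := by linarith

/-! ### Comparison with the barrier -/

/-- A function of growth `o(R^β)` lies below `ε |x - z|^β` far from `z`. -/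
theorem SupIsLittleO.exists_forall_le {n : ℕ} {T : ℝ} {z : Eucl n} {u : Eucl n → ℝ → ℝ} {β : ℝ}
    (hu : SupIsLittleO T z u β) {ε : ℝ} (hε : 0 < ε) :
    ∃ R : ℝ, ∀ x, R ≤ ‖x - z‖ → ∀ t ∈ Ioo 0 T, u x t ≤ ε * ‖x - z‖ ^ β := by
  obtain ⟨R, hR⟩ := eventually_atTop.1 ((hu.2.bound hε).and (eventually_gt_atTop 0))
  refine ⟨R, fun x hx t ht => ?_⟩
  obtain ⟨h1, h2⟩ := hR _ hx
  rw [Real.norm_of_nonneg (Real.rpow_nonneg h2.le β)] at h1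
  refine le_trans ?_ ((le_abs_self _).trans h1)
  exact le_csSup (hu.1 _ h2) ⟨(x, t), ⟨by simp [dist_eq_norm], ht⟩, rfl⟩

/-- A subsolution lying below `M` initially stays below the barrier. -/
theorem IsViscSubsolution.le_barrier {n : ℕ} {T : ℝ} {H : Eucl n → Mat n → ℝ} {Z χ : ℝ → ℝ}
    {σ : ℝ} {u : Eucl n → ℝ → ℝ} (hu : IsViscSubsolution T H Z χ σ u)
    (husc : UpperSemicontinuousOn (fun a : Eucl n × ℝ => u a.1 a.2) (univ ×ˢ Ico 0 T))
    {M : ℝ} (hM : ∀ x, u x 0 ≤ M) {z : Eucl n} {β : ℝ} (hβ : 0 < β) (hgr : SupIsLittleO T z u β)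
    {k₁ : ℝ} (hB : ConditionB H k₁) (hk₁ : 0 < k₁) {L : ℝ}
    (hL : ∀ (e : Eucl n) (l : ℝ), ‖e‖ = 1 → H e (l • tensorSq e + 1) ≤ L)
    {C : ℝ} (hC : ∀ t ∈ Ioo 0 T, |χ t| ≤ C) {d K : ℝ} (hd : 0 ≤ d) (hK : 0 ≤ K)
    (hrate : ∀ p r : ℝ, 0 < p → p ≤ 1 → 0 ≤ r →
      L * ((β * p * (1 + r ^ 2) ^ (β / 2 - 1)) ^ (k₁ + 1) * r ^ k₁) +
        C * (β * p * (1 + r ^ 2) ^ (β / 2 - 1) * r) ^ σ ≤ d + K * p * (1 + r ^ 2) ^ (β / 2))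
    {ε η : ℝ} (hε : 0 < ε) (hη : 0 < η) (hεK : ε * Real.exp (K * T) ≤ 1) (x : Eucl n) {t : ℝ}
    (ht : t ∈ Ioo 0 T) : u x t ≤ barrier T M d K ε η β z x t := by
  by_contra! hlt
  set ψ := barrier T M d K ε η β z with hψ
  have hT : 0 < T := ht.1.trans ht.2
  have hp : ∀ s, 0 ≤ s → ε ≤ ε * Real.exp (K * s) := fun s hs =>
    le_mul_of_one_le_right hε.le (Real.one_le_exp (by positivity))
  -- far from `z` the barrier dominates
  obtain ⟨R₁, hR₁⟩ := hgr.exists_forall_le (half_pos hε)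
  obtain ⟨R₂, hR₂⟩ := eventually_atTop.1
    ((((tendsto_rpow_atTop hβ).const_mul_atTop (half_pos hε)).eventually_ge_atTop (-M)).and
      (eventually_gt_atTop 0))
  set R := max (max R₁ R₂) ‖x - z‖
  have hRpos : 0 < R := (hR₂ R₂ le_rfl).2.trans_le ((le_max_right _ _).trans (le_max_left _ _))
  have hfar : ∀ y, R ≤ ‖y - z‖ → ∀ s ∈ Ioo 0 T, u y s ≤ ψ y s := fun y hy s hs => by
    have h1 := hR₁ y (((le_max_left _ _).trans (le_max_left _ _)).trans hy) s hs
    have h2 := (hR₂ ‖y - z‖ (((le_max_right _ _).trans (le_max_left _ _)).trans hy)).1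
    have h3 : ‖y - z‖ ^ β ≤ bracketSq z y ^ (β / 2) := by
      have : ‖y - z‖ ^ β = (‖y - z‖ ^ 2) ^ (β / 2) := by
        rw [← Real.rpow_natCast, ← Real.rpow_mul (norm_nonneg _)]; congr 1; push_cast; ring
      rw [this]
      refine Real.rpow_le_rpow (by positivity) ?_ (by positivity)
      unfold bracketSq; linarith
    have h4 : ε * ‖y - z‖ ^ β ≤ ε * Real.exp (K * s) * bracketSq z y ^ (β / 2) :=
      mul_le_mul (hp s hs.1.le) h3 (by positivity) (by positivity)
    have h5 : 0 ≤ d * s := mul_nonneg hd hs.1.le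
    have h6 : 0 < η / (T - s) := div_pos hη (sub_pos.2 hs.2)
    simp only [hψ, barrier]
    linarith
  -- near the final time the barrier dominates on the ball
  obtain ⟨B, hBd⟩ := hgr.1 R hRpos
  have hBd' : ∀ y, ‖y - z‖ ≤ R → ∀ s ∈ Ioo 0 T, u y s ≤ B := fun y hy s hs =>
    hBd ⟨(y, s), ⟨by simpa [dist_eq_norm] using hy, hs⟩, rfl⟩
  set N := max (B - M) 1
  have hN : 0 < N := lt_max_of_lt_right one_pos
  have hlate : ∀ y, ‖y - z‖ ≤ R → ∀ s ∈ Ioo 0 T, T - η / N ≤ s → u y s ≤ ψ y s :=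
    fun y hy s hs hsN => by
      have h1 := hBd' y hy s hs
      have h2 : N ≤ η / (T - s) := by
        rw [le_div_iff₀ (sub_pos.2 hs.2)]
        have : T - s ≤ η / N := by linarith
        rw [le_div_iff₀ hN] at this
        linarith
      have h3 : B - M ≤ N := le_max_left _ _
      have h5 : 0 ≤ d * s := mul_nonneg hd hs.1.le
      have h6 := Real.rpow_pos_of_pos (bracketSq_pos z y) (β / 2)
      have h7 : 0 < ε * Real.exp (K * s) * bracketSq z y ^ (β / 2) := by positivity
      simp only [hψ, barrier]
      linarith
  have hinit : ∀ y, u y 0 ≤ ψ y 0 := fun y => by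
    have h6 := Real.rpow_pos_of_pos (bracketSq_pos z y) (β / 2)
    have h7 : 0 < ε * Real.exp (K * 0) * bracketSq z y ^ (β / 2) := by positivity
    have h8 : 0 < η / (T - 0) := by rw [sub_zero]; positivity
    have := hM y
    simp only [hψ, barrier]
    linarith
  -- hence the positive maximum of `u - ψ` is attained at an interior point
  set T₁ := max t (T - η / N)
  have hT₁ : T₁ < T := max_lt ht.2 (sub_lt_self _ (by positivity))
  set D : Set (Eucl n × ℝ) := Metric.closedBall z R ×ˢ Icc 0 T₁
  have hDsub : D ⊆ univ ×ˢ Ico 0 T := fun a ha => ⟨trivial, ha.2.1, ha.2.2.trans_lt hT₁⟩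
  have hxD : (x, t) ∈ D :=
    ⟨mem_closedBall_iff_norm.2 (le_max_right _ _), ht.1.le, le_max_left _ _⟩
  have hψc : ContinuousOn (fun a : Eucl n × ℝ => ψ a.1 a.2) D := by
    have h1 := (continuous_bracketSq_rpow z (β / 2)).comp (continuous_fst (X := Eucl n) (Y := ℝ))
    simp only [hψ, barrier]
    refine ContinuousOn.add (Continuous.continuousOn ?_) ?_
    · exact (by fun_prop : Continuous fun a : Eucl n × ℝ => M + d * a.2).add
        ((by fun_prop : Continuous fun a : Eucl n × ℝ => ε * Real.exp (K * a.2)).mul h1)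
    · exact continuousOn_const.div (by fun_prop) fun a ha =>
        (sub_pos.2 (hDsub ha).2.2).ne'
  have hφ : UpperSemicontinuousOn (fun a : Eucl n × ℝ => u a.1 a.2 - ψ a.1 a.2) D := by
    simp only [sub_eq_add_neg]
    exact (husc.mono hDsub).add hψc.neg.upperSemicontinuousOn
  obtain ⟨⟨y, s⟩, hyD, hmax⟩ := hφ.exists_isMaxOn ⟨_, hxD⟩
    ((isCompact_closedBall z R).prod isCompact_Icc)
  have hpos : 0 < u y s - ψ y s := (sub_pos.2 hlt).trans_le (hmax hxD)
  have hs : s ∈ Ioo 0 T := by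
    refine ⟨lt_of_le_of_ne hyD.2.1 ?_, hyD.2.2.trans_lt hT₁⟩
    rintro rfl
    linarith [hinit y]
  -- Off `D`, u - ψ ≤ 0 lies below the positive maximum, so the maximum is global in the open strip
  -- even if (y, s) is on the boundary of `D`.
  have hloc : IsLocalMax (fun a : Eucl n × ℝ => u a.1 a.2 - ψ a.1 a.2) (y, s) := by
    have hopen : (univ ×ˢ Ioo 0 T : Set (Eucl n × ℝ)) ∈ 𝓝 (y, s) :=
      (isOpen_univ.prod isOpen_Ioo).mem_nhds ⟨trivial, hs⟩
    filter_upwards [hopen] with a ha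
    by_cases h1 : R ≤ ‖a.1 - z‖
    · linarith [hfar a.1 h1 a.2 ha.2]
    by_cases h2 : T - η / N ≤ a.2
    · linarith [hlate a.1 (not_le.1 h1).le a.2 ha.2 h2]
    · exact hmax ⟨by simpa [dist_eq_norm] using (not_le.1 h1).le, ha.2.1.le,
        (not_le.1 h2).le.trans (le_max_right _ _)⟩
  -- the equation fails there
  have hineq := hu _ _ _ _ (isTestFunction_barrier T M d K ε η β z) y s hs hloc
  set p := ε * Real.exp (K * s) with hpdef
  have hp0 : 0 < p := by positivity
  have hp1 : p ≤ 1 := by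
    refine le_trans ?_ hεK
    have := mul_le_mul_of_nonneg_left hs.2.le hK
    rw [hpdef]
    gcongr
  set A := barrierSlope K ε β z y s with hAdef
  have hA0 : 0 < A := barrierSlope_pos hε hβ z y s
  have hH : H (A • (y - z)) (barrierHess K ε β z y s + Z (u y s) • tensorSq (A • (y - z))) ≤
      L * (A ^ (k₁ + 1) * ‖y - z‖ ^ k₁) := by
    -- The Z term only changes the coefficient of the rank-one part.
    have h1 : barrierHess K ε β z y s + Z (u y s) • tensorSq (A • (y - z)) =
        (β * p * (2 * (β / 2 - 1) * bracketSq z y ^ (β / 2 - 1 - 1)) + Z (u y s) * A ^ 2) •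
          tensorSq (y - z) + A • 1 := by
      rw [tensorSq_smul, smul_smul, add_smul, barrierHess, add_right_comm]
    rw [h1]
    exact apply_radial_le hB hk₁ hL hA0 _ _
  have hχ : χ s * ‖A • (y - z)‖ ^ σ ≤ C * (A * ‖y - z‖) ^ σ := by
    rw [norm_smul, Real.norm_of_nonneg hA0.le]
    exact mul_le_mul_of_nonneg_right ((le_abs_self _).trans (hC s hs)) (by positivity)
  have hr := hrate p ‖y - z‖ hp0 hp1 (norm_nonneg _)
  have hη' : 0 < η / (T - s) ^ 2 := div_pos hη (pow_pos (sub_pos.2 hs.2) 2)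
  have hAr : A = β * p * (1 + ‖y - z‖ ^ 2) ^ (β / 2 - 1) := rfl
  have htime : barrierTime T d K ε η β z y s =
      d + K * p * (1 + ‖y - z‖ ^ 2) ^ (β / 2) + η / (T - s) ^ 2 := rfl
  rw [← hAr] at hr
  linarith

/-- A subsolution of admissible growth exceeds its initial bound by at most `d t`. -/
theorem IsViscSubsolution.le_add_mul {n : ℕ} {T : ℝ} {H : Eucl n → Mat n → ℝ} {Z χ : ℝ → ℝ}
    {σ : ℝ} {u : Eucl n → ℝ → ℝ} (hu : IsViscSubsolution T H Z χ σ u)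
    (husc : UpperSemicontinuousOn (fun a : Eucl n × ℝ => u a.1 a.2) (univ ×ˢ Ico 0 T))
    {M : ℝ} (hM : ∀ x, u x 0 ≤ M) {z : Eucl n} {β : ℝ} (hβ : 0 < β) (hgr : SupIsLittleO T z u β)
    {k₁ : ℝ} (hA : ConditionA H) (hB : ConditionB H k₁) (hk₁ : 0 < k₁) (hΛ : LambdaSupFinite H)
    {C : ℝ} (hC0 : 0 ≤ C) (hC : ∀ t ∈ Ioo 0 T, |χ t| ≤ C)
    (hβk : (β - 1) * k₁ ≤ 2) (hσ : 0 ≤ σ) (hβσ : (β - 1) * σ ≤ β)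
    {d : ℝ} (hd : 0 ≤ d) (hd0 : σ = 0 → C ≤ d) (hd1 : 0 < σ → 0 < d) (x : Eucl n) {t : ℝ}
    (ht : t ∈ Ioo 0 T) : u x t ≤ M + d * t := by
  obtain ⟨L, hL0, hL⟩ := exists_bound_of_lambdaSupFinite hA hΛ
  obtain ⟨K, hK, hrate⟩ := exists_barrier_rate hβ hk₁.le hL0 hC0 hβk hσ hβσ hd hd0 hd1
  -- K was fixed before ε, so ε e^{KT} ≤ 1 holds for all small ε.
  have hlim : Tendsto (fun ε => barrier T M d K ε ε β z x t) (𝓝[>] 0) (𝓝 (M + d * t)) := by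
    have : Continuous fun ε => barrier T M d K ε ε β z x t := by unfold barrier; fun_prop
    have h2 := (this.tendsto 0).mono_left (nhdsWithin_le_nhds (s := Ioi 0))
    simpa [barrier] using h2
  have hsmall : ∀ᶠ ε : ℝ in 𝓝[>] 0, ε * Real.exp (K * T) ≤ 1 := by
    have : Continuous fun ε : ℝ => ε * Real.exp (K * T) := by fun_prop
    have h2 := (this.tendsto 0).mono_left (nhdsWithin_le_nhds (s := Ioi 0))
    rw [zero_mul] at h2
    exact h2.eventually_le_const one_pos
  refine ge_of_tendsto hlim ?_
  filter_upwards [hsmall, self_mem_nhdsWithin] with ε h1 hε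
  exact hu.le_barrier husc hM hβ hgr hB hk₁ hL hC hd hK hrate hε hε h1 x ht

theorem IsViscSubsolution.le_of_sigma_pos {n : ℕ} {T : ℝ} {H : Eucl n → Mat n → ℝ} {Z χ : ℝ → ℝ}
    {σ : ℝ} {u : Eucl n → ℝ → ℝ} (hu : IsViscSubsolution T H Z χ σ u)
    (husc : UpperSemicontinuousOn (fun a : Eucl n × ℝ => u a.1 a.2) (univ ×ˢ Ico 0 T))
    {M : ℝ} (hM : ∀ x, u x 0 ≤ M) {z : Eucl n} {β : ℝ} (hβ : 0 < β) (hgr : SupIsLittleO T z u β)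
    {k₁ : ℝ} (hA : ConditionA H) (hB : ConditionB H k₁) (hk₁ : 0 < k₁) (hΛ : LambdaSupFinite H)
    {C : ℝ} (hC0 : 0 ≤ C) (hC : ∀ t ∈ Ioo 0 T, |χ t| ≤ C)
    (hβk : (β - 1) * k₁ ≤ 2) (hσ : 0 < σ) (hβσ : (β - 1) * σ ≤ β) (x : Eucl n) {t : ℝ}
    (ht : t ∈ Ioo 0 T) : u x t ≤ M := by
  refine le_of_forall_pos_le_add fun δ hδ => ?_
  -- Any positive slope d is allowed when σ > 0; this one makes dt = δ.
  have hd : 0 < δ / t := div_pos hδ ht.1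
  have := hu.le_add_mul husc hM hβ hgr hA hB hk₁ hΛ hC0 hC hβk hσ.le hβσ hd.le
    (fun h => absurd h hσ.ne') (fun _ => hd) x ht
  rwa [div_mul_cancel₀ _ ht.1.ne'] at this

/-! ### The two critical exponents -/

theorem theorem2p6 (n : ℕ) (hn : 2 ≤ n)
    (H : Eucl n → Mat n → ℝ) (k₁ k γ : ℝ)
    (hA : ConditionA H) (hB : ConditionB H k₁) (hC : ConditionC H) (hΛ : LambdaSupFinite H)
    (hk_def : k = k₁ + 1) (hγ_def : γ = k + 1) (hk : 1 < k)
    (T : ℝ) (hT : 0 < T)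
    (h : Eucl n → ℝ) (hh_cont : Continuous h) (hh_bdd : BddAbove (range h))
    (χ : ℝ → ℝ) (hχ_cont : ContinuousOn χ (Ioo 0 T)) (hχ_bdd : ∃ C, ∀ t ∈ Ioo 0 T, |χ t| ≤ C)
    -- `m` is a real number or `-∞`; `Z` is considered on `[m, ∞)` only
    (m : WithBot ℝ) (Z : ℝ → ℝ)
    (hZ_cont : ContinuousOn Z {s : ℝ | m ≤ (s : WithBot ℝ)})
    (hZ_anti : AntitoneOn Z {s : ℝ | m ≤ (s : WithBot ℝ)})
    (hZ_nonneg : ∀ s : ℝ, m ≤ (s : WithBot ℝ) → 0 ≤ Z s)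
    (σ : ℝ) (hσ : 0 ≤ σ)
    (u : Eucl n → ℝ → ℝ)
    (hu_usc : UpperSemicontinuousOn (fun a : Eucl n × ℝ => u a.1 a.2) (univ ×ˢ Ico 0 T))
    -- `inf u > m`, no restriction if `m = -∞`
    (hu_inf : m = ⊥ ∨ ∃ c : ℝ, m < (c : WithBot ℝ) ∧ ∀ x, ∀ t ∈ Ioo 0 T, c ≤ u x t)
    (hu_sub : IsViscSubsolution T H Z χ σ u)
    (hu_init : ∀ x, u x 0 ≤ h x)
    (z : Eucl n) :
    (σ ≤ γ / 2 → SupIsLittleO T z u (γ / (γ - 2)) →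
      (σ = 0 → ∀ x, ∀ t ∈ Ioo 0 T, u x t ≤ (⨆ y, h y) + t * ⨆ s : Ioo 0 T, |χ s|) ∧
      (0 < σ → ∀ x, ∀ t ∈ Ioo 0 T, u x t ≤ ⨆ y, h y)) ∧
    (γ / 2 < σ → SupIsLittleO T z u (σ / (σ - 1)) →
      ∀ x, ∀ t ∈ Ioo 0 T, u x t ≤ ⨆ y, h y) := by
  have hk₁ : 0 < k₁ := by linarith
  have hγ2 : γ - 2 = k₁ := by linarith
  have hM : ∀ x, u x 0 ≤ ⨆ y, h y := fun x => (hu_init x).trans (le_ciSup hh_bdd x)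
  set C := ⨆ s : Ioo 0 T, |χ s| with hCdef
  have hC : ∀ t ∈ Ioo 0 T, |χ t| ≤ C := fun t ht => by
    obtain ⟨B, hB⟩ := hχ_bdd
    exact le_ciSup (f := fun s : Ioo 0 T => |χ s|) ⟨B, by rintro _ ⟨s, rfl⟩; exact hB s s.2⟩ ⟨t, ht⟩
  have hC0 : 0 ≤ C := Real.iSup_nonneg fun _ => abs_nonneg _
  constructor
  · intro hσγ hgr
    have hγ : 0 < γ := by linarith
    -- As γ* - 1 = 2/k₁, the condition on k₁ is an equality and the one on σ reads σ ≤ γ/2.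
    have hβ1 : γ / (γ - 2) - 1 = 2 / k₁ := by
      rw [hγ2]; field_simp; linarith
    have hβ : 0 < γ / (γ - 2) := by rw [hγ2]; positivity
    have hβk : (γ / (γ - 2) - 1) * k₁ ≤ 2 := by rw [hβ1, div_mul_cancel₀ _ hk₁.ne']
    have hβσ : (γ / (γ - 2) - 1) * σ ≤ γ / (γ - 2) := by
      rw [hβ1, hγ2, div_mul_eq_mul_div]
      gcongr
      linarith
    refine ⟨fun hσ0 x t ht => ?_, fun hσ0 x t ht => ?_⟩
    · rw [mul_comm]
      exact hu_sub.le_add_mul hu_usc hM hβ hgr hA hB hk₁ hΛ hC0 hC hβk hσ hβσ hC0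
        (fun _ => le_rfl) (fun h => absurd hσ0 h.ne') x ht
    · exact hu_sub.le_of_sigma_pos hu_usc hM hβ hgr hA hB hk₁ hΛ hC0 hC hβk hσ0 hβσ x ht
  · intro hσγ hgr x t ht
    have hσ1 : 0 < σ - 1 := by linarith
    have hσ0 : 0 < σ := by linarith
    -- The roles swap: the σ condition is an equality, and the k₁ condition reads k₁ ≤ 2(σ - 1),
    -- that is σ ≥ γ/2.
    have hβ1 : σ / (σ - 1) - 1 = 1 / (σ - 1) := by field_simp; ring
    refine hu_sub.le_of_sigma_pos hu_usc hM (div_pos hσ0 hσ1) hgr hA hB hk₁ hΛ hC0 hC ?_ hσ0 ?_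
      x ht
    · rw [hβ1, div_mul_eq_mul_div, div_le_iff₀ hσ1]; linarith
    · rw [hβ1, div_mul_eq_mul_div, one_mul]
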